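/- For $X\in\mathbb C^{d\times d}$ let $\|X\|_{HS}=\sqrt{\operatorname{tr}(X^\dagger X)}$. An $n$-outcome POVM on $\mathbb C^d$ is a tuple $M=(M_1,\dots,M_n)$ of positive semidefinite $d\times d$ matrices with $\sum_i M_i=\mathbb 1$. For a probability measure $\nu$ on the unitary group $U(d)$ let $\mathcal T_{k,\nu}(\rho)=\int U^{\otimes k}\rho\,(U^\dagger)^{\otimes k}\,d\nu(U)$, and let $\mu$ be the Haar probability measure; $\nu$ is a $\delta$-approximate $k$-design if $\|\mathcal T_{k,\nu}-\mathcal T_{k,\mu}\|_\diamond\le\delta$, where $\|\Phi\|_\diamond=\sup_{m}\sup_{\|X\|_1\le 1}\|(\Phi\otimes \mathrm{id}_m)(X)\|_1$ is the diamond norm. **Theorem.** There is an absolute constant $\varepsilon\in[0,1)$ such that the following holds for all positive integers $d,n$, all $n$-outcome POVMs $M,N$ on $\mathbb C^d$, every pure state $\psi_0=|\psi_0\rangle\langle\psi_0|$ on $\mathbb C^d$, every $\delta'\in(0,\tfrac13)$, and every probability measure $\nu$ on $U(d)$ that is a $\delta$-approximate $4$-design with $\delta=\delta'/(2d)^8$.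 Put $p_i^{M,\psi_V}=\operatorname{tr}(V\psi_0V^\dagger M_i)$ for $V\in U(d)$, $d_{TV}(p,q)=\frac12\sum_{i=1}^n|p_i-q_i|$, and $$d_{av}(M,N)=\frac1{2d}\sum_{i=1}^n\sqrt{\|M_i-N_i\|_{HS}^2+\big(\operatorname{tr}(M_i-N_i)\big)^2}.$$ Then $$\Big|\;\mathbb E_{V\sim\nu}\,d_{TV}\big(p^{M,\psi_V},p^{N,\psi_V}\big)-d_{av}(M,N)\;\Big|\;\le\;\varepsilon\; d_{av}(M,N).$$ -/

import Mathlib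

open Matrix MeasureTheory
open scoped ComplexConjugate ComplexOrder ENNReal BigOperators

noncomputable section

namespace AvgDist

/-! ### The unitary group `U(d)` as a compact measurable group -/

/-- `U(d)` carries its Borel σ-algebra. -/
instance unitaryMeasurableSpace (d : ℕ) : MeasurableSpace (unitaryGroup (Fin d) ℂ) := borel _

instance unitaryBorelSpace (d : ℕ) : BorelSpace (unitaryGroup (Fin d) ℂ) := ⟨rfl⟩

instance unitaryCompactSpace (d : ℕ) : CompactSpace (unitaryGroup (Fin d) ℂ) := by
  have hK : IsCompact {A : Matrix (Fin d) (Fin d) ℂ | ∀ i j, A i j ∈ Metric.closedBall (0 : ℂ) 1} := by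
    have h := isCompact_univ_pi (X := fun _ : Fin d => Fin d → ℂ)
      (s := fun _ => Set.univ.pi fun _ => Metric.closedBall (0 : ℂ) 1)
      (fun _ => isCompact_univ_pi fun _ => isCompact_closedBall (0 : ℂ) 1)
    have e : {A : Matrix (Fin d) (Fin d) ℂ | ∀ i j, A i j ∈ Metric.closedBall (0 : ℂ) 1}
        = (Set.univ.pi fun _ : Fin d => Set.univ.pi fun _ : Fin d =>
            Metric.closedBall (0 : ℂ) 1 : Set (Fin d → Fin d → ℂ)) :=
      Set.ext fun A => ⟨fun hA i _ j _ => hA i j, fun hA i j => hA i trivial j trivial⟩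
    rw [e]
    exact h
  refine isCompact_iff_compactSpace.mp (hK.of_isClosed_subset isClosed_unitary ?_)
  intro U hU i j
  simpa using entry_norm_bound_of_unitary hU i j

/-- The Haar probability measure on `U(d)`. -/
def haarUnitary (d : ℕ) : Measure (unitaryGroup (Fin d) ℂ) :=
  Measure.haarMeasure ⊤

instance haarUnitary_isProbabilityMeasure (d : ℕ) : IsProbabilityMeasure (haarUnitary d) :=
  ⟨by simpa [haarUnitary] using Measure.haarMeasure_self (G := unitaryGroup (Fin d) ℂ) (K₀ := ⊤)⟩

/-! ### Trace norm and diamond norm -/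

/-- The trace norm `‖X‖₁ = tr √(X† X)`, i.e. the sum of the singular values of `X`. -/
def traceNorm {ι : Type*} [Fintype ι] [DecidableEq ι] (X : Matrix ι ι ℂ) : ℝ :=
  ∑ i, √((isHermitian_conjTranspose_mul_self X).eigenvalues i)

/-- The extension `Φ ⊗ id_m`: apply `Φ` to every `ι × ι` block of a matrix indexed by
`ι × Fin m`. -/
def ampliation {ι : Type*} (Φ : Matrix ι ι ℂ →ₗ[ℂ] Matrix ι ι ℂ) (m : ℕ)
    (X : Matrix (ι × Fin m) (ι × Fin m) ℂ) : Matrix (ι × Fin m) (ι × Fin m) ℂ :=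
  Matrix.of fun p q => Φ (Matrix.of fun i j => X (i, p.2) (j, q.2)) p.1 q.1

/-- The diamond norm: the supremum over all finite-dimensional ancillas of the norm of
`Φ ⊗ id_m` induced by the trace norm, as an extended nonnegative real. -/
def diamondNorm {ι : Type*} [Fintype ι] [DecidableEq ι]
    (Φ : Matrix ι ι ℂ →ₗ[ℂ] Matrix ι ι ℂ) : ℝ≥0∞ :=
  ⨆ (m : ℕ) (X : Matrix (ι × Fin m) (ι × Fin m) ℂ) (_ : traceNorm X ≤ 1),
    ENNReal.ofReal (traceNorm (ampliation Φ m X))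

/-! ### Approximate unitary designs -/

/-- The tensor power `A^{⊗ k}`, on `(ℂ^d)^{⊗ k}` with basis indexed by `Fin k → Fin d`. -/
def tensorPow {d : ℕ} (k : ℕ) (A : Matrix (Fin d) (Fin d) ℂ) :
    Matrix (Fin k → Fin d) (Fin k → Fin d) ℂ :=
  Matrix.of fun i j => ∏ l, A (i l) (j l)

theorem integrable_twirl_entry {d k : ℕ} (ν : Measure (unitaryGroup (Fin d) ℂ))
    [IsProbabilityMeasure ν] (ρ : Matrix (Fin k → Fin d) (Fin k → Fin d) ℂ)
    (i j : Fin k → Fin d) :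
    Integrable (fun U : unitaryGroup (Fin d) ℂ =>
      (tensorPow k (U : Matrix (Fin d) (Fin d) ℂ) * ρ
        * (tensorPow k (U : Matrix (Fin d) (Fin d) ℂ))ᴴ) i j) ν := by
  refine Continuous.integrable_of_hasCompactSupport ?_ (HasCompactSupport.of_compactSpace _)
  have h : Continuous fun U : unitaryGroup (Fin d) ℂ =>
      tensorPow k (U : Matrix (Fin d) (Fin d) ℂ) := by
    refine continuous_matrix fun a b => ?_
    have hl : ∀ l : Fin k, Continuous fun U : unitaryGroup (Fin d) ℂ =>
        (U : Matrix (Fin d) (Fin d) ℂ) (a l) (b l) :=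
      fun l => continuous_subtype_val.matrix_elem _ _
    simpa [tensorPow] using continuous_finsetProd Finset.univ fun l _ => hl l
  exact ((h.matrix_mul continuous_const).matrix_mul h.matrix_conjTranspose).matrix_elem _ _

/-- The `k`-fold twirl `ρ ↦ ∫ U^{⊗ k} ρ (U†)^{⊗ k} dν(U)`, the integral being taken entrywise. -/
def twirl {d : ℕ} (k : ℕ) (ν : Measure (unitaryGroup (Fin d) ℂ)) [IsProbabilityMeasure ν] :
    Matrix (Fin k → Fin d) (Fin k → Fin d) ℂ →ₗ[ℂ] Matrix (Fin k → Fin d) (Fin k → Fin d) ℂ where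
  toFun ρ := Matrix.of fun i j =>
    ∫ U : unitaryGroup (Fin d) ℂ, (tensorPow k (U : Matrix (Fin d) (Fin d) ℂ) * ρ
      * (tensorPow k (U : Matrix (Fin d) (Fin d) ℂ))ᴴ) i j ∂ν
  map_add' ρ σ := by
    ext i j
    simp only [Matrix.mul_add, Matrix.add_mul, Matrix.add_apply, Matrix.of_apply]
    exact integral_add (integrable_twirl_entry ν ρ i j) (integrable_twirl_entry ν σ i j)
  map_smul' c ρ := by
    ext i j
    simp only [Matrix.mul_smul, Matrix.smul_mul, Matrix.smul_apply, Matrix.of_apply,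
      RingHom.id_apply]
    exact integral_smul c _

/-- `ν` is a `δ`-approximate unitary `k`-design: `‖T_{k,ν} - T_{k,Haar}‖_⋄ ≤ δ`. -/
def IsApproxDesign {d : ℕ} (k : ℕ) (δ : ℝ) (ν : Measure (unitaryGroup (Fin d) ℂ))
    [IsProbabilityMeasure ν] : Prop :=
  diamondNorm (twirl k ν - twirl k (haarUnitary d)) ≤ ENNReal.ofReal δ

/-! ### Quantum measurements and their outcome statistics -/

/-- An `n`-outcome POVM on `ℂ^d`. -/
structure POVM (d n : ℕ) where
  /-- The effects `M_1, …, M_n`. -/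
  effect : Fin n → Matrix (Fin d) (Fin d) ℂ
  posSemidef : ∀ i, (effect i).PosSemidef
  sum_eq_one : ∑ i, effect i = 1

/-- The projector `|ψ⟩⟨ψ|` onto a vector `ψ ∈ ℂ^d`. -/
def ketBra {d : ℕ} (ψ : EuclideanSpace ℂ (Fin d)) : Matrix (Fin d) (Fin d) ℂ :=
  Matrix.of fun a b => ψ a * conj (ψ b)

/-- The Born rule `p_i = tr (V |ψ⟩⟨ψ| V† M_i)` (the trace is real, and we take its real part). -/
def outcomeProb {d n : ℕ} (M : POVM d n) (ψ : EuclideanSpace ℂ (Fin d))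
    (V : unitaryGroup (Fin d) ℂ) (i : Fin n) : ℝ :=
  (((V : Matrix (Fin d) (Fin d) ℂ) * ketBra ψ * (V : Matrix (Fin d) (Fin d) ℂ)ᴴ
    * M.effect i).trace).re

/-- Total variation distance of two distributions on `n` outcomes. -/
def tvDist {n : ℕ} (p q : Fin n → ℝ) : ℝ :=
  (1 / 2) * ∑ i, |p i - q i|

/-- The Hilbert–Schmidt norm `√tr(X† X)`. -/
def hsNorm {d : ℕ} (X : Matrix (Fin d) (Fin d) ℂ) : ℝ :=
  √((Xᴴ * X).trace.re)

/-- The average-case distance of POVMs,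
`(1/2d) ∑ᵢ √(‖M_i - N_i‖_HS² + (tr (M_i - N_i))²)`. -/
def avgDistMeas {d n : ℕ} (M N : POVM d n) : ℝ :=
  (1 / (2 * (d : ℝ))) * ∑ i,
    √(hsNorm (M.effect i - N.effect i) ^ 2 + (M.effect i - N.effect i).trace.re ^ 2)

end AvgDist

end

/-!
Put `X = M_i - N_i`, a Hermitian matrix, and let `S(V) = ⟨V ψ₀, X V ψ₀⟩` be the difference of the
probabilities of outcome `i`. The total variation distance is half the sum over `i` of `|S|`, so it
is enough to show that `𝔼_ν |S|` is comparable to `a / d` with absolute constants, where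
`a² = ‖X‖_HS² + (tr X)²` (`traceHsNorm`). An upper bound follows from the second moment of `S`; a
lower bound follows from the second and fourth moments, because
`|s| ≥ s² / t - s⁴ / t³` for every `t > 0`. With `𝔼 S²` between `(1/4) (a/d)²` and
`(3/2) (a/d)²` and `𝔼 S⁴ ≤ 25 (a/d)⁴`, the choice `t = 16 a / d` gives the theorem with the
constant `127/128`.

For the Haar measure the moments come from a recursion, `moment_recursion`. Writing `⟨A⟩` for the
expectation value of `A` in the state `V ψ₀`, invariance under `V ↦ exp (t K) V` shows that the
average of `⟨A⟩ ⟨B⟩ ⟨C⟩ ⟨D⟩` has derivative zero, that is, the sum over the four factors of the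
averages with one factor replaced by its commutator with `K` vanishes. This is complex-linear in
`K`, hence true for every matrix `K`; taking `A = |a⟩⟨b| X`, `K = |b⟩⟨a|` and summing over `a, b`
gives
`(d + 3) 𝔼⟨X⟩⟨B⟩⟨C⟩⟨D⟩ = tr X 𝔼⟨B⟩⟨C⟩⟨D⟩ + 𝔼⟨BX⟩⟨C⟩⟨D⟩ + 𝔼⟨B⟩⟨CX⟩⟨D⟩ + 𝔼⟨B⟩⟨C⟩⟨DX⟩`.
It yields `𝔼 S² = a² / (d (d + 1))` and `𝔼 S⁴ ≤ 24 a⁴ / d⁴`, since `|tr X^k| ≤ a^k`.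

For an approximate design, the moments are linear functionals of the twirl of `ψ₀^{⊗ 4}`, and the
diamond norm bounds every entry of the difference of the two twirls
(`norm_moment_sub_le`). The accuracy `δ' / (2d)^8` makes the resulting error at most
`(a/d)² / 768` and `(a/d)⁴ / 768`, respectively.
-/

noncomputable section

namespace AvgDist

/-! ### Expectation values in a rotated pure state -/

variable {d : ℕ}

/-- The expectation value `⟨A⟩ = tr (V |ψ⟩⟨ψ| V† A)` of a matrix `A` in the rotated state `V ψ`. -/
def expVal (ψ : EuclideanSpace ℂ (Fin d)) (A : Matrix (Fin d) (Fin d) ℂ)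
    (V : unitaryGroup (Fin d) ℂ) : ℂ :=
  ((V : Matrix (Fin d) (Fin d) ℂ) * ketBra ψ * (V : Matrix (Fin d) (Fin d) ℂ)ᴴ * A).trace

theorem ketBra_eq_vecMulVec (ψ : EuclideanSpace ℂ (Fin d)) :
    ketBra ψ = vecMulVec ψ.ofLp (star ψ.ofLp) := rfl

theorem star_dotProduct_self_eq_one {ψ : EuclideanSpace ℂ (Fin d)} (hψ : ‖ψ‖ = 1) :
    star ψ.ofLp ⬝ᵥ ψ.ofLp = 1 := by
  have h := inner_self_eq_norm_sq_to_K (𝕜 := ℂ) ψ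
  rw [hψ, EuclideanSpace.inner_eq_star_dotProduct, dotProduct_comm] at h
  simpa using h

theorem rotated_ketBra_eq_vecMulVec (ψ : EuclideanSpace ℂ (Fin d))
    (V : Matrix (Fin d) (Fin d) ℂ) :
    V * ketBra ψ * Vᴴ = vecMulVec (V *ᵥ ψ.ofLp) (star (V *ᵥ ψ.ofLp)) := by
  rw [ketBra_eq_vecMulVec, mul_vecMulVec, vecMulVec_mul, star_mulVec]

theorem star_dotProduct_rotated {ψ : EuclideanSpace ℂ (Fin d)} (hψ : ‖ψ‖ = 1)
    (V : unitaryGroup (Fin d) ℂ) :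
    star ((V : Matrix (Fin d) (Fin d) ℂ) *ᵥ ψ.ofLp) ⬝ᵥ
      ((V : Matrix (Fin d) (Fin d) ℂ) *ᵥ ψ.ofLp) = 1 := by
  have hV : (V : Matrix (Fin d) (Fin d) ℂ)ᴴ * (V : Matrix (Fin d) (Fin d) ℂ) = 1 :=
    UnitaryGroup.star_mul_self V
  rw [star_mulVec, dotProduct_mulVec, vecMul_vecMul, hV, vecMul_one,
    star_dotProduct_self_eq_one hψ]

theorem expVal_eq_dotProduct (ψ : EuclideanSpace ℂ (Fin d)) (A : Matrix (Fin d) (Fin d) ℂ)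
    (V : unitaryGroup (Fin d) ℂ) :
    expVal ψ A V = star ((V : Matrix (Fin d) (Fin d) ℂ) *ᵥ ψ.ofLp) ⬝ᵥ
      A *ᵥ ((V : Matrix (Fin d) (Fin d) ℂ) *ᵥ ψ.ofLp) := by
  rw [expVal, rotated_ketBra_eq_vecMulVec, vecMulVec_mul, trace_vecMulVec, dotProduct_mulVec,
    dotProduct_comm]

theorem expVal_add (ψ : EuclideanSpace ℂ (Fin d)) (A B : Matrix (Fin d) (Fin d) ℂ)
    (V : unitaryGroup (Fin d) ℂ) : expVal ψ (A + B) V = expVal ψ A V + expVal ψ B V := by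
  simp [expVal, Matrix.mul_add]

theorem expVal_sub (ψ : EuclideanSpace ℂ (Fin d)) (A B : Matrix (Fin d) (Fin d) ℂ)
    (V : unitaryGroup (Fin d) ℂ) : expVal ψ (A - B) V = expVal ψ A V - expVal ψ B V := by
  simp [expVal, Matrix.mul_sub]

theorem expVal_smul (ψ : EuclideanSpace ℂ (Fin d)) (c : ℂ) (A : Matrix (Fin d) (Fin d) ℂ)
    (V : unitaryGroup (Fin d) ℂ) : expVal ψ (c • A) V = c * expVal ψ A V := by
  simp [expVal]

theorem expVal_sum {ι : Type*} (s : Finset ι) (ψ : EuclideanSpace ℂ (Fin d))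
    (A : ι → Matrix (Fin d) (Fin d) ℂ) (V : unitaryGroup (Fin d) ℂ) :
    expVal ψ (∑ i ∈ s, A i) V = ∑ i ∈ s, expVal ψ (A i) V := by
  simp [expVal, Matrix.mul_sum, trace_sum]

theorem expVal_one {ψ : EuclideanSpace ℂ (Fin d)} (hψ : ‖ψ‖ = 1) (V : unitaryGroup (Fin d) ℂ) :
    expVal ψ 1 V = 1 := by
  rw [expVal_eq_dotProduct, one_mulVec, star_dotProduct_rotated hψ]

@[fun_prop]
theorem continuous_expVal (ψ : EuclideanSpace ℂ (Fin d)) (A : Matrix (Fin d) (Fin d) ℂ) :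
    Continuous (expVal ψ A) := by
  have h : Continuous fun V : unitaryGroup (Fin d) ℂ => (V : Matrix (Fin d) (Fin d) ℂ) :=
    continuous_subtype_val
  exact ((((h.matrix_mul continuous_const).matrix_mul h.matrix_conjTranspose).matrix_mul
    continuous_const).matrix_trace)

theorem integrable_of_continuous {E : Type*} [NormedAddCommGroup E]
    (ν : Measure (unitaryGroup (Fin d) ℂ)) [IsProbabilityMeasure ν]
    {f : unitaryGroup (Fin d) ℂ → E} (hf : Continuous f) : Integrable f ν :=
  hf.integrable_of_hasCompactSupport (HasCompactSupport.of_compactSpace _)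

/-- Summing over the commutators with all matrix units merges two expectation values into one.
The rotated state is a unit vector `φ`, so the factor `∑ₐ φ̄ₐ φₐ` from the first half of the
commutator equals `1`. -/
theorem sum_expVal_single_mul (ψ : EuclideanSpace ℂ (Fin d)) (hψ : ‖ψ‖ = 1)
    (X Y : Matrix (Fin d) (Fin d) ℂ) (V : unitaryGroup (Fin d) ℂ) :
    ∑ a, ∑ b, expVal ψ (single a b 1 * X) V *
      expVal ψ (Y * single b a 1 - single b a 1 * Y) V
      = expVal ψ (Y * X) V - expVal ψ X V * expVal ψ Y V := by
  simp only [expVal_sub]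
  simp only [expVal_eq_dotProduct]
  have h1 := star_dotProduct_rotated hψ V
  set w := (V : Matrix (Fin d) (Fin d) ℂ) *ᵥ ψ.ofLp
  have e1 : ∀ (Z : Matrix (Fin d) (Fin d) ℂ) a b,
      star w ⬝ᵥ (single a b 1 * Z) *ᵥ w = star w a * (Z *ᵥ w) b := by
    intro Z a b
    rw [← mulVec_mulVec, single_mulVec]
    simp [Function.update, dotProduct]
  have e2 : ∀ (Z : Matrix (Fin d) (Fin d) ℂ) a b,
      star w ⬝ᵥ (Z * single b a 1) *ᵥ w = (star w ᵥ* Z) b * w a := by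
    intro Z a b
    rw [← mulVec_mulVec, single_mulVec, dotProduct_mulVec]
    simp [Function.update, dotProduct]
  simp only [e1, e2]
  have e3 : star w ⬝ᵥ (Y * X) *ᵥ w = (star w ᵥ* Y) ⬝ᵥ (X *ᵥ w) := by
    rw [← mulVec_mulVec, dotProduct_mulVec]
  calc _ = (star w ⬝ᵥ w) * ((star w ᵥ* Y) ⬝ᵥ (X *ᵥ w))
        - (star w ⬝ᵥ (Y *ᵥ w)) * (star w ⬝ᵥ (X *ᵥ w)) := by
        simp only [dotProduct, Finset.sum_mul_sum, ← Finset.sum_sub_distrib]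
        refine Finset.sum_congr rfl fun a _ => Finset.sum_congr rfl fun b _ => ?_
        ring
    _ = _ := by rw [h1, e3]; ring

theorem sum_commutator_single (X : Matrix (Fin d) (Fin d) ℂ) :
    ∑ a, ∑ b, (single a b 1 * X * single b a 1 - single b a 1 * (single a b 1 * X))
      = X.trace • (1 : Matrix (Fin d) (Fin d) ℂ) - (d : ℂ) • X := by
  ext i j
  simp only [Finset.sum_sub_distrib]
  simp only [Matrix.sub_apply, Matrix.sum_apply, Matrix.smul_apply, ← Matrix.mul_assoc,
    single_mul_single_same, mul_one]
  simp [Matrix.mul_apply, single_apply, trace, Matrix.one_apply, ite_and, eq_comm]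
  

/-! ### Infinitesimal invariance of the Haar measure -/

section Derivative

open scoped Matrix.Norms.Operator

theorem hasDerivAt_expVal_exp_smul (ψ : EuclideanSpace ℂ (Fin d))
    (A K : Matrix (Fin d) (Fin d) ℂ) (hK : Kᴴ = -K) (V : unitaryGroup (Fin d) ℂ)
    (U : ℝ → unitaryGroup (Fin d) ℂ)
    (hU : ∀ t, (U t : Matrix (Fin d) (Fin d) ℂ) = NormedSpace.exp (t • K)) (t : ℝ) :
    HasDerivAt (fun t => expVal ψ A (U t * V)) (expVal ψ (A * K - K * A) (U t * V)) t := by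
  have h1 : HasDerivAt (fun t => (U t : Matrix (Fin d) (Fin d) ℂ))
      (K * (U t : Matrix (Fin d) (Fin d) ℂ)) t := by
    simp only [hU]
    exact hasDerivAt_exp_smul_const' K t
  have hUs : ∀ t, (U t : Matrix (Fin d) (Fin d) ℂ)ᴴ = NormedSpace.exp (t • (-K)) := fun t => by
    rw [hU, ← exp_conjTranspose, conjTranspose_smul, hK]
    simp
  have h2 : HasDerivAt (fun t => (U t : Matrix (Fin d) (Fin d) ℂ)ᴴ)
      ((U t : Matrix (Fin d) (Fin d) ℂ)ᴴ * -K) t := by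
    simp only [hUs]
    exact hasDerivAt_exp_smul_const (-K) t
  have h3 := ((h1.mul_const ((V : Matrix (Fin d) (Fin d) ℂ) * ketBra ψ *
    (V : Matrix (Fin d) (Fin d) ℂ)ᴴ)).mul h2).mul_const A
  have h4 := ((traceLinearMap (Fin d) ℝ ℂ).toContinuousLinearMap.hasFDerivAt.comp_hasDerivAt t h3)
  refine (h4.congr_deriv ?_).congr_of_eventuallyEq (.of_forall fun s => ?_)
  · change trace (_ : Matrix (Fin d) (Fin d) ℂ) = _
    simp only [expVal, Submonoid.coe_mul, conjTranspose_mul, Matrix.mul_add, Matrix.add_mul, trace_add,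
      Matrix.mul_neg, Matrix.neg_mul, trace_neg, Matrix.mul_assoc, sub_eq_add_neg]
    rw [trace_mul_comm K]
    simp only [Matrix.mul_assoc]
  · simp [expVal, Matrix.mul_assoc]

end Derivative

instance haarUnitary_isMulLeftInvariant : (haarUnitary d).IsMulLeftInvariant := by
  unfold haarUnitary
  infer_instance

/-- The derivative of `⟨A⟩ ⟨B⟩ ⟨C⟩ ⟨D⟩` along `V ↦ exp (t K) V`: each factor in turn is replaced by
the expectation value of its commutator with `K`. -/
def commutatorSum (ψ : EuclideanSpace ℂ (Fin d)) (A B C D K : Matrix (Fin d) (Fin d) ℂ)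
    (V : unitaryGroup (Fin d) ℂ) : ℂ :=
  expVal ψ (A * K - K * A) V * (expVal ψ B V * expVal ψ C V * expVal ψ D V)
    + expVal ψ A V * (expVal ψ (B * K - K * B) V * expVal ψ C V * expVal ψ D V
      + expVal ψ B V * expVal ψ (C * K - K * C) V * expVal ψ D V
      + expVal ψ B V * expVal ψ C V * expVal ψ (D * K - K * D) V)

@[fun_prop]
theorem continuous_commutatorSum (ψ : EuclideanSpace ℂ (Fin d))
    (A B C D K : Matrix (Fin d) (Fin d) ℂ) : Continuous (commutatorSum ψ A B C D K) := by
  unfold commutatorSum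
  fun_prop

/-- Left invariance makes `t ↦ ∫ (⟨A⟩ ⟨B⟩ ⟨C⟩ ⟨D⟩)(exp (t K) V) dV` constant; the claim is that its
derivative at `0` vanishes. -/
theorem integral_commutatorSum_of_skew (ψ : EuclideanSpace ℂ (Fin d))
    (A B C D K : Matrix (Fin d) (Fin d) ℂ) (hK : Kᴴ = -K) :
    ∫ V, commutatorSum ψ A B C D K V ∂(haarUnitary d) = 0 := by
  have hmem : ∀ t : ℝ, NormedSpace.exp (t • K) ∈ unitaryGroup (Fin d) ℂ := fun t => by
    rw [mem_unitaryGroup_iff', star_eq_conjTranspose, ← exp_conjTranspose, conjTranspose_smul, hK,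
      star_trivial, smul_neg, ← Matrix.exp_add_of_commute _ _ (Commute.refl (t • K)).neg_left,
      neg_add_cancel, NormedSpace.exp_zero]
  let U : ℝ → unitaryGroup (Fin d) ℂ := fun t => ⟨_, hmem t⟩
  let G : unitaryGroup (Fin d) ℂ → ℂ := fun V =>
    expVal ψ A V * (expVal ψ B V * expVal ψ C V * expVal ψ D V)
  have hG : Continuous G := by fun_prop
  obtain ⟨c, hc⟩ := isCompact_univ.exists_bound_of_continuousOn
    (continuous_commutatorSum ψ A B C D K).continuousOn
  have hd : ∀ (V : unitaryGroup (Fin d) ℂ) (t : ℝ),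
      HasDerivAt (fun t => G (U t * V)) (commutatorSum ψ A B C D K (U t * V)) t := fun V t => by
    have hA := hasDerivAt_expVal_exp_smul ψ A K hK V U (fun _ => rfl) t
    have hB := hasDerivAt_expVal_exp_smul ψ B K hK V U (fun _ => rfl) t
    have hC := hasDerivAt_expVal_exp_smul ψ C K hK V U (fun _ => rfl) t
    have hD := hasDerivAt_expVal_exp_smul ψ D K hK V U (fun _ => rfl) t
    refine (hA.mul ((hB.mul hC).mul hD)).congr_deriv ?_
    simp only [commutatorSum, Pi.mul_apply]
    ring
  have key := (hasDerivAt_integral_of_dominated_loc_of_deriv_le (μ := haarUnitary d)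
    (F := fun t V => G (U t * V)) (x₀ := (0 : ℝ)) (bound := fun _ => c)
    (F' := fun t V => commutatorSum ψ A B C D K (U t * V)) Filter.univ_mem
    (.of_forall fun t => (hG.comp (continuous_const_mul _)).aestronglyMeasurable)
    (integrable_of_continuous _ (hG.comp (continuous_const_mul _)))
    ((continuous_commutatorSum ψ A B C D K).comp (continuous_const_mul _)).aestronglyMeasurable
    (.of_forall fun V t _ => hc _ (Set.mem_univ _)) (integrable_const c)
    (.of_forall fun V t _ => hd V t)).2
  simp only [integral_mul_left_eq_self G] at key
  have h0 := key.unique (hasDerivAt_const _ _)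
  rwa [integral_mul_left_eq_self (commutatorSum ψ A B C D K)] at h0

/-- Every matrix is a complex combination of skew-Hermitian ones, and the commutator is
complex-linear in `K`, so the infinitesimal invariance holds for all `K`. -/
theorem integral_commutatorSum (ψ : EuclideanSpace ℂ (Fin d))
    (A B C D K : Matrix (Fin d) (Fin d) ℂ) :
    ∫ V, commutatorSum ψ A B C D K V ∂(haarUnitary d) = 0 := by
  have hlin : ∀ V, commutatorSum ψ A B C D K V
      = (-Complex.I) * commutatorSum ψ A B C D (Complex.I • (realPart K : Matrix _ _ ℂ)) V
        + commutatorSum ψ A B C D (Complex.I • (imaginaryPart K : Matrix _ _ ℂ)) V := fun V => by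
    conv_lhs => rw [← realPart_add_I_smul_imaginaryPart K]
    have h : ∀ Z P Q : Matrix (Fin d) (Fin d) ℂ,
        expVal ψ (Z * (P + Complex.I • Q) - (P + Complex.I • Q) * Z) V
          = -Complex.I * expVal ψ (Z * (Complex.I • P) - (Complex.I • P) * Z) V
            + expVal ψ (Z * (Complex.I • Q) - (Complex.I • Q) * Z) V := fun Z P Q => by
      rw [← expVal_smul, ← expVal_add]
      congr 1
      simp only [Matrix.mul_add, Matrix.add_mul, mul_smul_comm, smul_mul_assoc, smul_sub,
        smul_smul, neg_mul, Complex.I_mul_I, neg_neg, one_smul]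
      abel
    simp only [commutatorSum, h]
    ring
  have hskew : ∀ H : selfAdjoint (Matrix (Fin d) (Fin d) ℂ),
      (Complex.I • (H : Matrix (Fin d) (Fin d) ℂ))ᴴ = -(Complex.I • (H : Matrix _ _ ℂ)) :=
    fun H => by
      rw [conjTranspose_smul, ← star_eq_conjTranspose, H.2.star_eq]
      simp
  simp only [hlin]
  rw [integral_add, integral_const_mul, integral_commutatorSum_of_skew _ _ _ _ _ _ (hskew _),
    integral_commutatorSum_of_skew _ _ _ _ _ _ (hskew _)]
  · simp
  all_goals exact integrable_of_continuous _ (by fun_prop)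

/-! ### Recursion for the Haar moments -/

/-- The mixed moment `∫ ⟨A⟩ ⟨B⟩ ⟨C⟩ ⟨D⟩ dν` of four observables in the state `V ψ`. Since
`⟨1⟩ = 1`, moments of lower order are obtained by inserting the identity. -/
def moment (ν : Measure (unitaryGroup (Fin d) ℂ)) (ψ : EuclideanSpace ℂ (Fin d))
    (A B C D : Matrix (Fin d) (Fin d) ℂ) : ℂ :=
  ∫ V, expVal ψ A V * (expVal ψ B V * expVal ψ C V * expVal ψ D V) ∂ν

/-- The recursion that determines all Haar moments. It is the infinitesimal invariance for the
first observable `|a⟩⟨b| X` and the direction `K = |b⟩⟨a|`, summed over `a` and `b`. -/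
theorem moment_recursion {ψ : EuclideanSpace ℂ (Fin d)} (hψ : ‖ψ‖ = 1)
    (X B C D : Matrix (Fin d) (Fin d) ℂ) :
    (d + 3 : ℂ) * moment (haarUnitary d) ψ X B C D
      = X.trace * moment (haarUnitary d) ψ 1 B C D + moment (haarUnitary d) ψ (B * X) 1 C D
        + moment (haarUnitary d) ψ (C * X) B 1 D + moment (haarUnitary d) ψ (D * X) B C 1 := by
  have hsum : ∀ V, ∑ a, ∑ b, commutatorSum ψ (single a b 1 * X) B C D (single b a 1) V
      = X.trace * (expVal ψ 1 V * (expVal ψ B V * expVal ψ C V * expVal ψ D V))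
        + expVal ψ (B * X) V * (expVal ψ 1 V * expVal ψ C V * expVal ψ D V)
        + expVal ψ (C * X) V * (expVal ψ B V * expVal ψ 1 V * expVal ψ D V)
        + expVal ψ (D * X) V * (expVal ψ B V * expVal ψ C V * expVal ψ 1 V)
        - (d + 3) * (expVal ψ X V * (expVal ψ B V * expVal ψ C V * expVal ψ D V)) := fun V => by
    have h0 : ∑ a, ∑ b, expVal ψ (single a b 1 * X * single b a 1
        - single b a 1 * (single a b 1 * X)) V = X.trace * expVal ψ 1 V - d * expVal ψ X V := by
      simp only [← expVal_sum]
      rw [sum_commutator_single, expVal_sub, expVal_smul, expVal_smul]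
    have hB := sum_expVal_single_mul ψ hψ X B V
    have hC := sum_expVal_single_mul ψ hψ X C V
    have hD := sum_expVal_single_mul ψ hψ X D V
    calc _ = (∑ a, ∑ b, expVal ψ (single a b 1 * X * single b a 1
            - single b a 1 * (single a b 1 * X)) V)
              * (expVal ψ B V * expVal ψ C V * expVal ψ D V)
          + (∑ a, ∑ b, expVal ψ (single a b 1 * X) V *
              expVal ψ (B * single b a 1 - single b a 1 * B) V) * (expVal ψ C V * expVal ψ D V)
          + (∑ a, ∑ b, expVal ψ (single a b 1 * X) V *
              expVal ψ (C * single b a 1 - single b a 1 * C) V) * (expVal ψ B V * expVal ψ D V)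
          + (∑ a, ∑ b, expVal ψ (single a b 1 * X) V *
              expVal ψ (D * single b a 1 - single b a 1 * D) V)
                * (expVal ψ B V * expVal ψ C V) := by
          simp only [Finset.sum_mul, ← Finset.sum_add_distrib]
          refine Finset.sum_congr rfl fun a _ => Finset.sum_congr rfl fun b _ => ?_
          simp only [commutatorSum]
          ring
      _ = _ := by
          rw [h0, hB, hC, hD, expVal_one hψ]
          ring
  have h := integral_finsetSum (μ := haarUnitary d) Finset.univ (f := fun (a : Fin d) V =>
    ∑ b, commutatorSum ψ (single a b 1 * X) B C D (single b a 1) V)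
    (fun a _ => integrable_of_continuous _ (by fun_prop))
  have h' : ∀ a : Fin d, ∫ V, ∑ b, commutatorSum ψ (single a b 1 * X) B C D (single b a 1) V
      ∂(haarUnitary d) = 0 := fun a => by
    rw [integral_finsetSum _ fun b _ => integrable_of_continuous _ (by fun_prop)]
    exact Finset.sum_eq_zero fun b _ => integral_commutatorSum _ _ _ _ _ _
  simp only [h', hsum, Finset.sum_const_zero] at h
  rw [integral_sub, integral_add, integral_add, integral_add, integral_const_mul,
    integral_const_mul] at h
  · simp only [moment]
    linear_combination -h
  all_goals exact integrable_of_continuous _ (by fun_prop)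

/-! ### Hilbert–Schmidt estimates -/

theorem hsNorm_nonneg (X : Matrix (Fin d) (Fin d) ℂ) : 0 ≤ hsNorm X := Real.sqrt_nonneg _

theorem hsNorm_eq_sqrt_sum (X : Matrix (Fin d) (Fin d) ℂ) :
    hsNorm X = √(∑ i, ∑ j, ‖X i j‖ ^ 2) := by
  rw [hsNorm, Finset.sum_comm]
  congr 1
  simp [trace, Matrix.mul_apply, ← Complex.normSq_eq_norm_sq, Complex.normSq_apply]

section Frobenius

open scoped Matrix.Norms.Frobenius

theorem hsNorm_eq_norm (X : Matrix (Fin d) (Fin d) ℂ) : hsNorm X = ‖X‖ := by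
  rw [hsNorm_eq_sqrt_sum, frobenius_norm_def, Real.sqrt_eq_rpow]
  simp

theorem hsNorm_mul_le (A B : Matrix (Fin d) (Fin d) ℂ) : hsNorm (A * B) ≤ hsNorm A * hsNorm B := by
  simp only [hsNorm_eq_norm]
  exact frobenius_norm_mul A B

end Frobenius

theorem norm_trace_mul_le (A B : Matrix (Fin d) (Fin d) ℂ) :
    ‖(A * B).trace‖ ≤ hsNorm A * hsNorm B := by
  have h1 : hsNorm A = √(∑ p : Fin d × Fin d, ‖A p.1 p.2‖ ^ 2) := by
    rw [hsNorm_eq_sqrt_sum, Fintype.sum_prod_type]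
  have h2 : hsNorm B = √(∑ p : Fin d × Fin d, ‖B p.2 p.1‖ ^ 2) := by
    rw [hsNorm_eq_sqrt_sum, Fintype.sum_prod_type, Finset.sum_comm]
  have h3 : (A * B).trace = ∑ p : Fin d × Fin d, A p.1 p.2 * B p.2 p.1 := by
    simp [trace, Matrix.mul_apply, Fintype.sum_prod_type]
  rw [h1, h2, h3]
  refine (norm_sum_le _ _).trans ?_
  simp only [norm_mul]
  exact Real.sum_mul_le_sqrt_mul_sqrt _ _ _

theorem sum_norm_entry_le (X : Matrix (Fin d) (Fin d) ℂ) :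
    ∑ i, ∑ j, ‖X i j‖ ≤ d * hsNorm X := by
  have h := Real.sum_mul_le_sqrt_mul_sqrt Finset.univ (fun _ : Fin d × Fin d => (1 : ℝ))
    (fun p => ‖X p.1 p.2‖)
  rw [hsNorm_eq_sqrt_sum]
  simpa [Fintype.sum_prod_type, Real.sqrt_mul_self] using h

theorem norm_trace_pow_le {X : Matrix (Fin d) (Fin d) ℂ} {a : ℝ} (hX : hsNorm X ≤ a)
    (hT : ‖X.trace‖ ≤ a) (k : ℕ) : ‖(X ^ (k + 1)).trace‖ ≤ a ^ (k + 1) := by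
  have ha : 0 ≤ a := (hsNorm_nonneg X).trans hX
  have hpow : ∀ k : ℕ, hsNorm (X ^ (k + 1)) ≤ a ^ (k + 1) := fun k => by
    induction k with
    | zero => simpa using hX
    | succ k ih =>
      rw [pow_succ X, pow_succ a]
      exact (hsNorm_mul_le _ _).trans (mul_le_mul ih hX (hsNorm_nonneg _) (by positivity))
  cases k with
  | zero => simpa using hT
  | succ k =>
    rw [pow_succ X, pow_succ a]
    exact (norm_trace_mul_le _ _).trans
      (mul_le_mul (hpow k) hX (hsNorm_nonneg _) (by positivity))

/-! ### Haar moments up to order four -/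

section Recursion

variable {ψ : EuclideanSpace ℂ (Fin d)}

theorem moment_one_fst (ν : Measure (unitaryGroup (Fin d) ℂ)) (A B C : Matrix (Fin d) (Fin d) ℂ) :
    moment ν ψ 1 A B C = moment ν ψ A B C 1 := by
  simp only [moment]
  congr 1 with V
  ring

theorem moment_one_snd (ν : Measure (unitaryGroup (Fin d) ℂ)) (A B C : Matrix (Fin d) (Fin d) ℂ) :
    moment ν ψ A 1 B C = moment ν ψ A B C 1 := by
  simp only [moment]
  congr 1 with V
  ring

theorem moment_one_thd (ν : Measure (unitaryGroup (Fin d) ℂ)) (A B C : Matrix (Fin d) (Fin d) ℂ) :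
    moment ν ψ A B 1 C = moment ν ψ A B C 1 := by
  simp only [moment]
  congr 1 with V
  ring

theorem moment_one (hψ : ‖ψ‖ = 1) : moment (haarUnitary d) ψ 1 1 1 1 = 1 := by
  simp [moment, expVal_one hψ]

theorem moment_first (hψ : ‖ψ‖ = 1) (X : Matrix (Fin d) (Fin d) ℂ) :
    (d : ℂ) * moment (haarUnitary d) ψ X 1 1 1 = X.trace := by
  have h := moment_recursion hψ X 1 1 1
  simp only [one_mul, moment_one hψ] at h
  linear_combination h

theorem moment_second (hψ : ‖ψ‖ = 1) (X Y : Matrix (Fin d) (Fin d) ℂ) :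
    (d + 1 : ℂ) * moment (haarUnitary d) ψ X Y 1 1
      = X.trace * moment (haarUnitary d) ψ Y 1 1 1 + moment (haarUnitary d) ψ (Y * X) 1 1 1 := by
  have h := moment_recursion hψ X Y 1 1
  rw [moment_one_fst] at h
  simp only [one_mul] at h
  linear_combination h

theorem moment_third (hψ : ‖ψ‖ = 1) (X Y Z : Matrix (Fin d) (Fin d) ℂ) :
    (d + 2 : ℂ) * moment (haarUnitary d) ψ X Y Z 1
      = X.trace * moment (haarUnitary d) ψ Y Z 1 1 + moment (haarUnitary d) ψ (Y * X) Z 1 1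
        + moment (haarUnitary d) ψ (Z * X) Y 1 1 := by
  have h := moment_recursion hψ X Y Z 1
  rw [moment_one_fst, moment_one_snd] at h
  simp only [one_mul] at h
  linear_combination h

theorem moment_fourth (hψ : ‖ψ‖ = 1) (X Y Z W : Matrix (Fin d) (Fin d) ℂ) :
    (d + 3 : ℂ) * moment (haarUnitary d) ψ X Y Z W
      = X.trace * moment (haarUnitary d) ψ Y Z W 1 + moment (haarUnitary d) ψ (Y * X) Z W 1
        + moment (haarUnitary d) ψ (Z * X) Y W 1 + moment (haarUnitary d) ψ (W * X) Y Z 1 := by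
  have h := moment_recursion hψ X Y Z W
  rw [moment_one_fst, moment_one_snd, moment_one_thd] at h
  linear_combination h

theorem haar_second_moment (hψ : ‖ψ‖ = 1) (X : Matrix (Fin d) (Fin d) ℂ) :
    (d * (d + 1) : ℂ) * moment (haarUnitary d) ψ X X 1 1 = (X * X).trace + X.trace ^ 2 := by
  linear_combination (d : ℂ) * moment_second hψ X X + X.trace * moment_first hψ X
    + moment_first hψ (X * X)

/-- Unfolding the recursion gives `24` products of traces of powers of `X`, each of total degree four
and hence at most `a ^ 4`. -/
theorem haar_fourth_moment_le (hψ : ‖ψ‖ = 1) {X : Matrix (Fin d) (Fin d) ℂ} {a : ℝ}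
    (hX : hsNorm X ≤ a) (hT : ‖X.trace‖ ≤ a) :
    d ^ 4 * ‖moment (haarUnitary d) ψ X X X X‖ ≤ 24 * a ^ 4 := by
  have ha : 0 ≤ a := (hsNorm_nonneg X).trans hX
  have htr := norm_trace_pow_le hX hT
  have hd : ∀ (k : ℕ) (z : ℂ), (d : ℝ) * ‖z‖ ≤ ‖(d + k : ℂ) * z‖ := fun k z => by
    rw [norm_mul]
    gcongr
    have : (d + k : ℂ) = ((d + k : ℝ) : ℂ) := by push_cast; rfl
    rw [this, Complex.norm_of_nonneg (by positivity)]
    simp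
  have h1 : ∀ i : ℕ, d * ‖moment (haarUnitary d) ψ (X ^ (i + 1)) 1 1 1‖ ≤ a ^ (i + 1) := fun i => by
    have h := hd 0 (moment (haarUnitary d) ψ (X ^ (i + 1)) 1 1 1)
    rw [Nat.cast_zero, add_zero, moment_first hψ] at h
    exact h.trans (htr i)
  have h2 : ∀ i j : ℕ, d ^ 2 * ‖moment (haarUnitary d) ψ (X ^ (i + 1)) (X ^ (j + 1)) 1 1‖
      ≤ 2 * a ^ (i + j + 2) := fun i j => by
    have h := hd 1 (moment (haarUnitary d) ψ (X ^ (i + 1)) (X ^ (j + 1)) 1 1)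
    rw [Nat.cast_one, moment_second hψ, ← pow_add] at h
    calc _ = d * (d * ‖moment (haarUnitary d) ψ (X ^ (i + 1)) (X ^ (j + 1)) 1 1‖) := by ring
      _ ≤ d * (‖(X ^ (i + 1)).trace‖ * ‖moment (haarUnitary d) ψ (X ^ (j + 1)) 1 1 1‖
          + ‖moment (haarUnitary d) ψ (X ^ (j + 1 + (i + 1))) 1 1 1‖) := by
          gcongr
          exact h.trans ((norm_add_le _ _).trans_eq (by rw [norm_mul]))
      _ = ‖(X ^ (i + 1)).trace‖ * (d * ‖moment (haarUnitary d) ψ (X ^ (j + 1)) 1 1 1‖)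
          + d * ‖moment (haarUnitary d) ψ (X ^ (j + 1 + i + 1)) 1 1 1‖ := by
          rw [add_assoc (j + 1)]; ring
      _ ≤ a ^ (i + 1) * a ^ (j + 1) + a ^ (j + 1 + i + 1) := by
          gcongr
          exacts [htr i, h1 j, h1 _]
      _ = _ := by ring
  have h3 : ∀ i j k : ℕ,
      d ^ 3 * ‖moment (haarUnitary d) ψ (X ^ (i + 1)) (X ^ (j + 1)) (X ^ (k + 1)) 1‖
      ≤ 6 * a ^ (i + j + k + 3) := fun i j k => by
    have h := hd 2 (moment (haarUnitary d) ψ (X ^ (i + 1)) (X ^ (j + 1)) (X ^ (k + 1)) 1)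
    rw [Nat.cast_ofNat, moment_third hψ, ← pow_add, ← pow_add] at h
    calc _ = d ^ 2 *
          (d * ‖moment (haarUnitary d) ψ (X ^ (i + 1)) (X ^ (j + 1)) (X ^ (k + 1)) 1‖) := by ring
      _ ≤ d ^ 2 * (‖(X ^ (i + 1)).trace‖
            * ‖moment (haarUnitary d) ψ (X ^ (j + 1)) (X ^ (k + 1)) 1 1‖
          + ‖moment (haarUnitary d) ψ (X ^ (j + 1 + (i + 1))) (X ^ (k + 1)) 1 1‖
          + ‖moment (haarUnitary d) ψ (X ^ (k + 1 + (i + 1))) (X ^ (j + 1)) 1 1‖) := by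
          gcongr
          exact h.trans (norm_add₃_le.trans_eq (by rw [norm_mul]))
      _ = ‖(X ^ (i + 1)).trace‖
            * (d ^ 2 * ‖moment (haarUnitary d) ψ (X ^ (j + 1)) (X ^ (k + 1)) 1 1‖)
          + d ^ 2 * ‖moment (haarUnitary d) ψ (X ^ (j + 1 + i + 1)) (X ^ (k + 1)) 1 1‖
          + d ^ 2 * ‖moment (haarUnitary d) ψ (X ^ (k + 1 + i + 1)) (X ^ (j + 1)) 1 1‖ := by
          rw [add_assoc (j + 1), add_assoc (k + 1)]; ring
      _ ≤ a ^ (i + 1) * (2 * a ^ (j + k + 2)) + 2 * a ^ (j + 1 + i + k + 2)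
          + 2 * a ^ (k + 1 + i + j + 2) := by
          exact add_le_add_three (mul_le_mul (htr i) (h2 j k) (by positivity) (by positivity))
            (h2 _ _) (h2 _ _)
      _ = _ := by ring
  have h := hd 3 (moment (haarUnitary d) ψ X X X X)
  rw [Nat.cast_ofNat, moment_fourth hψ] at h
  have e1 := h3 0 0 0
  have e2 := h3 1 0 0
  simp only [zero_add, pow_one, add_zero, one_add_one_eq_two, Nat.reduceAdd] at e1 e2
  calc _ = d ^ 3 * (d * ‖moment (haarUnitary d) ψ X X X X‖) := by ring
    _ ≤ d ^ 3 * (‖X.trace‖ * ‖moment (haarUnitary d) ψ X X X 1‖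
        + ‖moment (haarUnitary d) ψ (X ^ 2) X X 1‖ + ‖moment (haarUnitary d) ψ (X ^ 2) X X 1‖
        + ‖moment (haarUnitary d) ψ (X ^ 2) X X 1‖) := by
        gcongr
        refine h.trans ((norm_add_le _ _).trans ?_)
        gcongr
        · exact norm_add₃_le.trans_eq (by rw [norm_mul, sq])
        · rw [sq]
    _ = ‖X.trace‖ * (d ^ 3 * ‖moment (haarUnitary d) ψ X X X 1‖)
        + 3 * (d ^ 3 * ‖moment (haarUnitary d) ψ (X ^ 2) X X 1‖) := by ring
    _ ≤ a * (6 * a ^ 3) + 3 * (6 * a ^ 4) := by gcongr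
    _ = _ := by ring

end Recursion

/-! ### Trace norm and diamond norm of pure states -/

section TraceNorm

variable {ι : Type*} [Fintype ι] [DecidableEq ι]

/-- An entry is bounded by the Hilbert–Schmidt norm, which is at most the trace norm. -/
theorem norm_entry_le_traceNorm (Y : Matrix ι ι ℂ) (i j : ι) : ‖Y i j‖ ≤ traceNorm Y := by
  have hpos := (posSemidef_conjTranspose_mul_self Y).eigenvalues_nonneg
  have htr := (isHermitian_conjTranspose_mul_self Y).trace_eq_sum_eigenvalues
  have hsum : ∑ k, (isHermitian_conjTranspose_mul_self Y).eigenvalues k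
      = ∑ b, ∑ a, ‖Y a b‖ ^ 2 := by
    have h : ((∑ k, (isHermitian_conjTranspose_mul_self Y).eigenvalues k : ℝ) : ℂ)
        = ((∑ b, ∑ a, ‖Y a b‖ ^ 2 : ℝ) : ℂ) := by
      push_cast
      refine htr.symm.trans ?_
      simp [trace, Matrix.mul_apply, ← Complex.conj_mul']
    exact_mod_cast h
  refine le_of_sq_le_sq ?_ (Finset.sum_nonneg fun _ _ => Real.sqrt_nonneg _)
  calc ‖Y i j‖ ^ 2 ≤ ∑ a, ‖Y a j‖ ^ 2 :=
        Finset.single_le_sum (f := fun a => ‖Y a j‖ ^ 2) (fun _ _ => by positivity)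
          (Finset.mem_univ i)
    _ ≤ ∑ b, ∑ a, ‖Y a b‖ ^ 2 :=
        Finset.single_le_sum (f := fun b => ∑ a, ‖Y a b‖ ^ 2)
          (fun _ _ => Finset.sum_nonneg fun _ _ => by positivity) (Finset.mem_univ j)
    _ = ∑ k, √((isHermitian_conjTranspose_mul_self Y).eigenvalues k) ^ 2 := by
        rw [← hsum]
        exact Finset.sum_congr rfl fun k _ => (Real.sq_sqrt (hpos k)).symm
    _ ≤ traceNorm Y ^ 2 :=
        Finset.sum_sq_le_sq_sum_of_nonneg fun _ _ => Real.sqrt_nonneg _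

/-- The trace norm of an orthogonal projection is its trace. -/
theorem traceNorm_of_isProj {P : Matrix ι ι ℂ} (hP : Pᴴ = P) (hPP : P * P = P) :
    (traceNorm P : ℂ) = P.trace := by
  have hH := isHermitian_conjTranspose_mul_self P
  have hpos := (posSemidef_conjTranspose_mul_self P).eigenvalues_nonneg
  have hQQ : Pᴴ * P * (Pᴴ * P) = Pᴴ * P := by rw [hP, hPP, hPP]
  have hidem : ∀ k, hH.eigenvalues k * hH.eigenvalues k = hH.eigenvalues k := fun k => by
    have h := hH.mulVec_eigenvectorBasis k
    have h2 : (Pᴴ * P) *ᵥ ((Pᴴ * P) *ᵥ (hH.eigenvectorBasis k).ofLp)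
        = (Pᴴ * P) *ᵥ (hH.eigenvectorBasis k).ofLp := by
      rw [mulVec_mulVec, hQQ]
    rw [h, mulVec_smul, h, smul_smul] at h2
    have hne : (hH.eigenvectorBasis k).ofLp ≠ 0 := fun h0 =>
      hH.eigenvectorBasis.orthonormal.ne_zero k (by ext a; simpa using congrFun h0 a)
    exact smul_left_injective ℝ hne h2
  have hsqrt : ∀ k, √(hH.eigenvalues k) = hH.eigenvalues k := fun k => by
    conv_lhs => rw [← hidem k]
    exact Real.sqrt_mul_self (hpos k)
  have htr := hH.trace_eq_sum_eigenvalues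
  have hT : (Pᴴ * P).trace = P.trace := by rw [hP, hPP]
  rw [hT] at htr
  rw [htr, traceNorm]
  push_cast
  exact Finset.sum_congr rfl fun k _ => by rw [hsqrt k]; rfl

/-- The diamond norm controls the entries of the image of a pure state; the one-dimensional ancilla
suffices. -/
theorem norm_entry_le_of_diamondNorm_le {Φ : Matrix ι ι ℂ →ₗ[ℂ] Matrix ι ι ℂ} {δ : ℝ}
    (hδ : 0 ≤ δ) (hΦ : diamondNorm Φ ≤ ENNReal.ofReal δ) {P : Matrix ι ι ℂ} (hP : Pᴴ = P)
    (hPP : P * P = P) (htr : P.trace = 1) (i j : ι) : ‖Φ P i j‖ ≤ δ := by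
  let e : ι × Fin 1 ≃ ι := Equiv.prodUnique ι (Fin 1)
  let X : Matrix (ι × Fin 1) (ι × Fin 1) ℂ := P.submatrix e e
  have hX : traceNorm X ≤ 1 := by
    have h1 : Xᴴ = X := by simp only [X, conjTranspose_submatrix, hP]
    have h2 : X * X = X := by simp only [X, submatrix_mul_equiv, hPP]
    have h3 : X.trace = 1 := by
      rw [← htr]
      exact Fintype.sum_equiv e _ _ fun _ => rfl
    have h := traceNorm_of_isProj h1 h2
    rw [h3] at h
    exact le_of_eq (by exact_mod_cast h)
  have h : ENNReal.ofReal (traceNorm (ampliation Φ 1 X)) ≤ ENNReal.ofReal δ :=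
    (le_iSup₂_of_le 1 X (le_iSup (fun _ : traceNorm X ≤ 1 =>
      ENNReal.ofReal (traceNorm (ampliation Φ 1 X))) hX)).trans hΦ
  rw [ENNReal.ofReal_le_ofReal_iff hδ] at h
  exact (norm_entry_le_traceNorm (ampliation Φ 1 X) (i, 0) (j, 0)).trans h

end TraceNorm

/-! ### Averages over approximate designs -/

variable {k : ℕ}

theorem sum_prod_eq_prod_sum {R : Type*} [CommSemiring R] (f : Fin k → Fin d → R) :
    ∑ i : Fin k → Fin d, ∏ l, f l (i l) = ∏ l, ∑ a, f l a := by
  rw [Finset.prod_univ_sum, Fintype.piFinset_univ]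

theorem sum_sum_prod_eq_prod_sum_sum {R : Type*} [CommSemiring R]
    (f : Fin k → Fin d → Fin d → R) :
    ∑ i : Fin k → Fin d, ∑ j : Fin k → Fin d, ∏ l, f l (i l) (j l)
      = ∏ l, ∑ a, ∑ b, f l a b := by
  rw [← sum_prod_eq_prod_sum]
  exact Finset.sum_congr rfl fun i _ => sum_prod_eq_prod_sum fun l b => f l (i l) b

theorem tensorPow_mul (A B : Matrix (Fin d) (Fin d) ℂ) :
    tensorPow k A * tensorPow k B = tensorPow k (A * B) := by
  ext i j
  simp only [tensorPow, Matrix.mul_apply, of_apply, ← Finset.prod_mul_distrib]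
  exact sum_prod_eq_prod_sum fun l b => A (i l) b * B b (j l)

theorem tensorPow_conjTranspose (A : Matrix (Fin d) (Fin d) ℂ) :
    (tensorPow k A)ᴴ = tensorPow k Aᴴ := by
  ext i j
  simp [tensorPow, conjTranspose_apply]

theorem trace_tensorPow (A : Matrix (Fin d) (Fin d) ℂ) :
    (tensorPow k A).trace = A.trace ^ k := by
  simpa [tensorPow, trace] using sum_prod_eq_prod_sum (k := k) fun _ a => A a a

theorem ketBra_conjTranspose (ψ : EuclideanSpace ℂ (Fin d)) : (ketBra ψ)ᴴ = ketBra ψ := by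
  ext i j
  simp [ketBra, conjTranspose_apply, mul_comm]

theorem ketBra_mul_self {ψ : EuclideanSpace ℂ (Fin d)} (hψ : ‖ψ‖ = 1) :
    ketBra ψ * ketBra ψ = ketBra ψ := by
  rw [ketBra_eq_vecMulVec, vecMulVec_mul_vecMulVec, star_dotProduct_self_eq_one hψ]
  simp

theorem trace_ketBra {ψ : EuclideanSpace ℂ (Fin d)} (hψ : ‖ψ‖ = 1) : (ketBra ψ).trace = 1 := by
  rw [ketBra_eq_vecMulVec, trace_vecMulVec, dotProduct_comm, star_dotProduct_self_eq_one hψ]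

theorem prod_expVal_eq_sum (ψ : EuclideanSpace ℂ (Fin d)) (A : Fin k → Matrix (Fin d) (Fin d) ℂ)
    (V : unitaryGroup (Fin d) ℂ) :
    ∏ l, expVal ψ (A l) V = ∑ i : Fin k → Fin d, ∑ j : Fin k → Fin d,
      (tensorPow k (V : Matrix (Fin d) (Fin d) ℂ) * tensorPow k (ketBra ψ)
        * (tensorPow k (V : Matrix (Fin d) (Fin d) ℂ))ᴴ) i j * ∏ l, A l (j l) (i l) := by
  simp only [tensorPow_conjTranspose, tensorPow_mul]
  simp only [tensorPow, of_apply, ← Finset.prod_mul_distrib]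
  rw [sum_sum_prod_eq_prod_sum_sum fun l a b => ((V : Matrix (Fin d) (Fin d) ℂ) * ketBra ψ
    * (V : Matrix (Fin d) (Fin d) ℂ)ᴴ) a b * A l b a]
  exact Finset.prod_congr rfl fun l _ => by simp [expVal, trace, Matrix.mul_apply]

theorem integral_prod_expVal (ν : Measure (unitaryGroup (Fin d) ℂ)) [IsProbabilityMeasure ν]
    (ψ : EuclideanSpace ℂ (Fin d)) (A : Fin k → Matrix (Fin d) (Fin d) ℂ) :
    ∫ V, ∏ l, expVal ψ (A l) V ∂ν = ∑ i : Fin k → Fin d, ∑ j : Fin k → Fin d,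
      twirl k ν (tensorPow k (ketBra ψ)) i j * ∏ l, A l (j l) (i l) := by
  simp only [prod_expVal_eq_sum]
  rw [integral_finsetSum _ fun i _ => integrable_finsetSum _ fun j _ =>
    (integrable_twirl_entry ν _ i j).mul_const _]
  refine Finset.sum_congr rfl fun i _ => ?_
  rw [integral_finsetSum _ fun j _ => (integrable_twirl_entry ν _ i j).mul_const _]
  exact Finset.sum_congr rfl fun j _ => integral_mul_const _ _

/-- A product of `k` expectation values is linear in the `k`-fold twirl of `ψ^{⊗ k}`, so an approximate
design nearly reproduces its Haar average. Estimating entry by entry costs a power of `d`, which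
the accuracy `δ' / (2d)^8` of the design absorbs. -/
theorem norm_integral_prod_expVal_sub_le {ν : Measure (unitaryGroup (Fin d) ℂ)}
    [IsProbabilityMeasure ν] {δ : ℝ} (hδ : 0 ≤ δ) (hν : IsApproxDesign k δ ν)
    {ψ : EuclideanSpace ℂ (Fin d)} (hψ : ‖ψ‖ = 1) (A : Fin k → Matrix (Fin d) (Fin d) ℂ) :
    ‖∫ V, ∏ l, expVal ψ (A l) V ∂ν - ∫ V, ∏ l, expVal ψ (A l) V ∂(haarUnitary d)‖
      ≤ δ * ∏ l, (d * hsNorm (A l)) := by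
  have hentry := norm_entry_le_of_diamondNorm_le hδ hν
    (P := tensorPow k (ketBra ψ)) (by rw [tensorPow_conjTranspose, ketBra_conjTranspose])
    (by rw [tensorPow_mul, ketBra_mul_self hψ]) (by rw [trace_tensorPow, trace_ketBra hψ, one_pow])
  simp only [LinearMap.sub_apply, Matrix.sub_apply] at hentry
  rw [integral_prod_expVal, integral_prod_expVal]
  simp only [← Finset.sum_sub_distrib, ← sub_mul]
  calc _ ≤ ∑ i : Fin k → Fin d, ∑ j : Fin k → Fin d, δ * ∏ l, ‖A l (j l) (i l)‖ := by
        refine (norm_sum_le _ _).trans (Finset.sum_le_sum fun i _ => (norm_sum_le _ _).trans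
          (Finset.sum_le_sum fun j _ => ?_))
        rw [norm_mul, norm_prod]
        gcongr
        exact hentry i j
    _ = δ * ∏ l, ∑ a, ∑ b, ‖A l b a‖ := by
        rw [← sum_sum_prod_eq_prod_sum_sum fun l a b => ‖A l b a‖]
        simp only [Finset.mul_sum]
    _ ≤ _ := by
        gcongr with l
        rw [Finset.sum_comm]
        exact sum_norm_entry_le (A l)

theorem norm_moment_sub_le {ν : Measure (unitaryGroup (Fin d) ℂ)}
    [IsProbabilityMeasure ν] {δ : ℝ} (hδ : 0 ≤ δ) (hν : IsApproxDesign 4 δ ν)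
    {ψ : EuclideanSpace ℂ (Fin d)} (hψ : ‖ψ‖ = 1) (A B C D : Matrix (Fin d) (Fin d) ℂ) :
    ‖moment ν ψ A B C D - moment (haarUnitary d) ψ A B C D‖
      ≤ δ * d ^ 4 * (hsNorm A * hsNorm B * hsNorm C * hsNorm D) := by
  have h := norm_integral_prod_expVal_sub_le hδ hν hψ ![A, B, C, D]
  simp only [Fin.prod_univ_four, Matrix.cons_val] at h
  simp only [moment, ← mul_assoc]
  exact h.trans_eq (by ring)

/-! ### The first absolute moment of an observable -/

theorem expVal_eq_ofReal (ψ : EuclideanSpace ℂ (Fin d)) {X : Matrix (Fin d) (Fin d) ℂ}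
    (hX : X.IsHermitian) (V : unitaryGroup (Fin d) ℂ) :
    expVal ψ X V = ((expVal ψ X V).re : ℂ) := by
  have h := hX.im_star_dotProduct_mulVec_self ((V : Matrix (Fin d) (Fin d) ℂ) *ᵥ ψ.ofLp)
  rw [← expVal_eq_dotProduct] at h
  exact Complex.ext (by simp) (by simpa using h)

theorem integral_expVal_sq (ν : Measure (unitaryGroup (Fin d) ℂ))
    {ψ : EuclideanSpace ℂ (Fin d)} (hψ : ‖ψ‖ = 1) {X : Matrix (Fin d) (Fin d) ℂ}
    (hX : X.IsHermitian) :
    ((∫ V, (expVal ψ X V).re ^ 2 ∂ν : ℝ) : ℂ) = moment ν ψ X X 1 1 := by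
  rw [moment, ← integral_complex_ofReal]
  congr 1 with V
  rw [expVal_one hψ, expVal_eq_ofReal ψ hX]
  push_cast
  simp only [Complex.ofReal_re]
  ring

theorem integral_expVal_pow_four (ν : Measure (unitaryGroup (Fin d) ℂ))
    (ψ : EuclideanSpace ℂ (Fin d)) {X : Matrix (Fin d) (Fin d) ℂ} (hX : X.IsHermitian) :
    ((∫ V, (expVal ψ X V).re ^ 4 ∂ν : ℝ) : ℂ) = moment ν ψ X X X X := by
  rw [moment, ← integral_complex_ofReal]
  congr 1 with V
  rw [expVal_eq_ofReal ψ hX]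
  push_cast
  simp only [Complex.ofReal_re]
  ring

theorem trace_mul_self_eq_hsNorm_sq {X : Matrix (Fin d) (Fin d) ℂ} (hX : X.IsHermitian) :
    (X * X).trace = ((hsNorm X ^ 2 : ℝ) : ℂ) := by
  have h : (Xᴴ * X).trace = ((∑ b, ∑ a, ‖X a b‖ ^ 2 : ℝ) : ℂ) := by
    simp [trace, Matrix.mul_apply, ← Complex.conj_mul']
  rw [hsNorm_eq_sqrt_sum, Real.sq_sqrt (by positivity), Finset.sum_comm, ← h, hX.eq]

theorem trace_eq_ofReal {X : Matrix (Fin d) (Fin d) ℂ} (hX : X.IsHermitian) :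
    X.trace = (X.trace.re : ℂ) := by
  have h : star X.trace = X.trace := by rw [← trace_conjTranspose, hX.eq]
  exact (Complex.conj_eq_iff_re.mp h).symm

/-- The weighted norm `√(‖X‖_HS² + (tr X)²)`. -/
def traceHsNorm (X : Matrix (Fin d) (Fin d) ℂ) : ℝ := √(hsNorm X ^ 2 + X.trace.re ^ 2)

theorem hsNorm_le_traceHsNorm (X : Matrix (Fin d) (Fin d) ℂ) : hsNorm X ≤ traceHsNorm X :=
  Real.le_sqrt_of_sq_le (by nlinarith)

theorem norm_trace_le_traceHsNorm {X : Matrix (Fin d) (Fin d) ℂ} (hX : X.IsHermitian) :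
    ‖X.trace‖ ≤ traceHsNorm X := by
  rw [trace_eq_ofReal hX, Complex.norm_real, Real.norm_eq_abs]
  exact Real.le_sqrt_of_sq_le (by rw [sq_abs]; nlinarith [sq_nonneg (hsNorm X)])

theorem hsNorm_one_sq : hsNorm (1 : Matrix (Fin d) (Fin d) ℂ) ^ 2 = d := by
  rw [hsNorm, Real.sq_sqrt] <;> simp

/-- The pointwise inequality behind the lower bound of a first absolute moment by second and fourth
moments; for `s = u t` it reads `u ^ 2 - u ^ 4 ≤ u`. -/
theorem sq_div_sub_pow_four_div_le_abs (s : ℝ) {t : ℝ} (ht : 0 < t) :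
    s ^ 2 / t - s ^ 4 / t ^ 3 ≤ |s| := by
  obtain ⟨u, hu⟩ : ∃ u, |s| = u * t := ⟨|s| / t, by field_simp⟩
  have hu0 : 0 ≤ u := nonneg_of_mul_nonneg_left (hu ▸ abs_nonneg s) ht
  have h2 : s ^ 2 = u ^ 2 * t ^ 2 := by rw [← sq_abs, hu]; ring
  have h4 : s ^ 4 = u ^ 4 * t ^ 4 := by rw [show s ^ 4 = (s ^ 2) ^ 2 by ring, h2]; ring
  have key : u ^ 2 - u ^ 4 ≤ u := by
    rcases le_total u 1 with h | h
    · nlinarith [pow_nonneg hu0 4]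
    · nlinarith [pow_le_pow_right₀ h (show 2 ≤ 4 by norm_num)]
  calc _ = (u ^ 2 - u ^ 4) * t := by rw [h2, h4]; field_simp
    _ ≤ u * t := by gcongr
    _ = _ := hu.symm

theorem abs_le_sq_div_add (s : ℝ) {t : ℝ} (ht : 0 < t) : |s| ≤ s ^ 2 / (2 * t) + t / 2 := by
  have h : s ^ 2 / (2 * t) + t / 2 - |s| = (|s| - t) ^ 2 / (2 * t) := by
    rw [← sq_abs s]; field_simp; ring
  have : 0 ≤ (|s| - t) ^ 2 / (2 * t) := by positivity
  linarith

theorem integral_abs_le_of_second_moment {ν : Measure (unitaryGroup (Fin d) ℂ)}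
    [IsProbabilityMeasure ν] {f : unitaryGroup (Fin d) ℂ → ℝ} (hf : Continuous f) {t : ℝ}
    (ht : 0 < t) : ∫ V, |f V| ∂ν ≤ (∫ V, f V ^ 2 ∂ν) / (2 * t) + t / 2 := by
  calc _ ≤ ∫ V, (f V ^ 2 / (2 * t) + t / 2) ∂ν :=
        integral_mono (integrable_of_continuous ν hf.abs)
          (integrable_of_continuous ν (by fun_prop)) fun V => abs_le_sq_div_add (f V) ht
    _ = _ := by
        rw [integral_add (integrable_of_continuous ν (by fun_prop)) (integrable_const _),
          integral_div]
        simp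

theorem le_integral_abs_of_fourth_moment {ν : Measure (unitaryGroup (Fin d) ℂ)}
    [IsProbabilityMeasure ν] {f : unitaryGroup (Fin d) ℂ → ℝ} (hf : Continuous f) {t : ℝ}
    (ht : 0 < t) :
    (∫ V, f V ^ 2 ∂ν) / t - (∫ V, f V ^ 4 ∂ν) / t ^ 3 ≤ ∫ V, |f V| ∂ν := by
  rw [← integral_div, ← integral_div, ← integral_sub
    (integrable_of_continuous ν (by fun_prop)) (integrable_of_continuous ν (by fun_prop))]
  exact integral_mono (integrable_of_continuous ν (by fun_prop))
    (integrable_of_continuous ν hf.abs) fun V => sq_div_sub_pow_four_div_le_abs (f V) ht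

section Design

variable {ψ : EuclideanSpace ℂ (Fin d)} {ν : Measure (unitaryGroup (Fin d) ℂ)}
  [IsProbabilityMeasure ν] {δ : ℝ} {X : Matrix (Fin d) (Fin d) ℂ}

theorem dim_pos (hψ : ‖ψ‖ = 1) : 0 < d := by
  rcases Nat.eq_zero_or_pos d with rfl | h
  · rw [Subsingleton.elim ψ 0, norm_zero] at hψ
    exact absurd hψ (by norm_num)
  · exact h

theorem design_second_moment_mem (hψ : ‖ψ‖ = 1) (hX : X.IsHermitian) (hδ : 0 ≤ δ)
    (hδd : δ * d ^ 8 ≤ 1 / 768) (hν : IsApproxDesign 4 δ ν) :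
    (1 / 4) * (traceHsNorm X / d) ^ 2 ≤ ∫ V, (expVal ψ X V).re ^ 2 ∂ν ∧
      ∫ V, (expVal ψ X V).re ^ 2 ∂ν ≤ (3 / 2) * (traceHsNorm X / d) ^ 2 := by
  have hd : (1 : ℝ) ≤ d := by exact_mod_cast dim_pos hψ
  set m := ∫ V, (expVal ψ X V).re ^ 2 ∂ν with hm
  set m' := ∫ V, (expVal ψ X V).re ^ 2 ∂(haarUnitary d) with hm'
  set a := traceHsNorm X
  have ha2 : a ^ 2 = hsNorm X ^ 2 + X.trace.re ^ 2 := Real.sq_sqrt (by positivity)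
  have hhaar : d * (d + 1) * m' = a ^ 2 := by
    have h := haar_second_moment hψ X
    rw [← integral_expVal_sq _ hψ hX, trace_mul_self_eq_hsNorm_sq hX, trace_eq_ofReal hX] at h
    rw [ha2]
    exact_mod_cast h
  have hdiff : |m - m'| ≤ δ * d ^ 4 * (hsNorm X ^ 2 * d) := by
    have h := norm_moment_sub_le hδ hν hψ X X 1 1
    rw [← integral_expVal_sq _ hψ hX, ← integral_expVal_sq _ hψ hX, ← Complex.ofReal_sub,
      Complex.norm_real, Real.norm_eq_abs] at h
    refine h.trans_eq ?_
    rw [← hsNorm_one_sq (d := d)]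
    ring
  have hh : hsNorm X ^ 2 ≤ a ^ 2 := by rw [ha2]; nlinarith
  set b := (a / d) ^ 2
  have hb : a ^ 2 = b * d ^ 2 := by simp only [b]; field_simp
  have hb0 : 0 ≤ b := sq_nonneg _
  have herr : |m - m'| ≤ b / 768 := by
    calc |m - m'| ≤ δ * d ^ 4 * (a ^ 2 * d) := hdiff.trans (by gcongr)
      _ = δ * d ^ 7 * b := by rw [hb]; ring
      _ ≤ δ * d ^ 8 * b := by gcongr; norm_num
      _ ≤ 1 / 768 * b := by gcongr
      _ = _ := by ring
  have h1 : (d + 1) * m' = d * b := by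
    have : (d : ℝ) * ((d + 1) * m') = d * (d * b) := by rw [← mul_assoc, hhaar, hb]; ring
    exact mul_left_cancel₀ (by positivity) this
  have hup : m' ≤ b := by nlinarith
  have hlo : b / 2 ≤ m' := by nlinarith
  obtain ⟨h3, h4⟩ := abs_le.mp herr
  constructor <;> linarith

theorem design_fourth_moment_le (hψ : ‖ψ‖ = 1) (hX : X.IsHermitian) (hδ : 0 ≤ δ)
    (hδd : δ * d ^ 8 ≤ 1 / 768) (hν : IsApproxDesign 4 δ ν) :
    ∫ V, (expVal ψ X V).re ^ 4 ∂ν ≤ 25 * (traceHsNorm X / d) ^ 4 := by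
  have hd : (1 : ℝ) ≤ d := by exact_mod_cast dim_pos hψ
  have hhaar := haar_fourth_moment_le hψ (hsNorm_le_traceHsNorm X) (norm_trace_le_traceHsNorm hX)
  have hdiff := norm_moment_sub_le hδ hν hψ X X X X
  rw [← integral_expVal_pow_four _ ψ hX, Complex.norm_real, Real.norm_eq_abs] at hhaar
  rw [← integral_expVal_pow_four _ ψ hX, ← integral_expVal_pow_four _ ψ hX, ← Complex.ofReal_sub,
    Complex.norm_real, Real.norm_eq_abs] at hdiff
  set m := ∫ V, (expVal ψ X V).re ^ 4 ∂ν
  set m' := ∫ V, (expVal ψ X V).re ^ 4 ∂(haarUnitary d)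
  set a := traceHsNorm X
  have ha : hsNorm X ≤ a := hsNorm_le_traceHsNorm X
  have hh := hsNorm_nonneg X
  set b := (a / d) ^ 4
  have hb : a ^ 4 = b * d ^ 4 := by simp only [b]; field_simp
  have hb0 : 0 ≤ b := by positivity
  have herr : |m - m'| ≤ b / 768 := by
    calc |m - m'| ≤ δ * d ^ 4 * (hsNorm X) ^ 4 := hdiff.trans_eq (by ring)
      _ ≤ δ * d ^ 4 * a ^ 4 := by gcongr
      _ = δ * d ^ 8 * b := by rw [hb]; ring
      _ ≤ 1 / 768 * b := by gcongr
      _ = _ := by ring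
  have h1 : |m'| ≤ 24 * b := by
    rw [hb] at hhaar
    have hd4 : (0 : ℝ) < d ^ 4 := by positivity
    exact le_of_mul_le_mul_left (by linarith) hd4
  linarith [le_abs_self m', (abs_le.mp herr).2]

theorem design_integral_abs_expVal (hψ : ‖ψ‖ = 1) (hX : X.IsHermitian) (hδ : 0 ≤ δ)
    (hδd : δ * d ^ 8 ≤ 1 / 768) (hν : IsApproxDesign 4 δ ν) :
    |∫ V, |(expVal ψ X V).re| ∂ν - traceHsNorm X / d| ≤ (127 / 128) * (traceHsNorm X / d) := by
  have hd : (0 : ℝ) < d := by exact_mod_cast dim_pos hψ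
  obtain ⟨h2l, h2u⟩ := design_second_moment_mem hψ hX hδ hδd hν
  have h4 := design_fourth_moment_le hψ hX hδ hδd hν
  have hf : Continuous fun V => (expVal ψ X V).re :=
    Complex.continuous_re.comp (continuous_expVal ψ X)
  have ha : 0 ≤ traceHsNorm X / d := div_nonneg (Real.sqrt_nonneg _) hd.le
  set b := traceHsNorm X / d with hb
  rcases ha.eq_or_lt with h0 | hpos
  -- For `b = 0` no scale `t > 0` is available, but then `X = 0` and both sides vanish.
  · have hX0 : X = 0 := by
      have h1 : traceHsNorm X = 0 := by
        rcases div_eq_zero_iff.mp (hb.symm.trans h0.symm) with h | h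
        · exact h
        · exact absurd h hd.ne'
      have h2 : hsNorm X = 0 := le_antisymm (h1 ▸ hsNorm_le_traceHsNorm X) (hsNorm_nonneg X)
      rw [← trace_conjTranspose_mul_self_eq_zero_iff, hX.eq, trace_mul_self_eq_hsNorm_sq hX, h2]
      simp
    simp [← h0, hX0, expVal]
  · have hup := integral_abs_le_of_second_moment (ν := ν) hf hpos
    -- The scale `16 b` makes the second-moment gain `b / 64` exceed the loss `25 b / 4096`.
    have hlo := le_integral_abs_of_fourth_moment (ν := ν) hf (t := 16 * b) (by positivity)
    have e1 : (∫ V, (expVal ψ X V).re ^ 2 ∂ν) / (2 * b) ≤ 3 / 4 * b := by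
      rw [div_le_iff₀ (by positivity)]
      linarith
    have e2 : b / 64 ≤ (∫ V, (expVal ψ X V).re ^ 2 ∂ν) / (16 * b) := by
      rw [le_div_iff₀ (by positivity)]
      linarith
    have e3 : (∫ V, (expVal ψ X V).re ^ 4 ∂ν) / (16 * b) ^ 3 ≤ 25 / 4096 * b := by
      rw [div_le_iff₀ (by positivity)]
      linarith
    rw [abs_le]
    constructor <;> linarith

end Design

end AvgDist

end

theorem theorem2 :
    ∃ ε : ℝ, 0 ≤ ε ∧ ε < 1 ∧
      ∀ (d n : ℕ) (M N : AvgDist.POVM d n)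
        (ψ₀ : EuclideanSpace ℂ (Fin d)) (_ : ‖ψ₀‖ = 1)
        (δ' : ℝ) (_ : 0 < δ') (_ : δ' < 1 / 3)
        (ν : Measure (unitaryGroup (Fin d) ℂ)) [IsProbabilityMeasure ν]
        (_ : AvgDist.IsApproxDesign 4 (δ' / (2 * (d : ℝ)) ^ 8) ν),
        |(∫ V, AvgDist.tvDist (AvgDist.outcomeProb M ψ₀ V) (AvgDist.outcomeProb N ψ₀ V) ∂ν)
            - AvgDist.avgDistMeas M N| ≤ ε * AvgDist.avgDistMeas M N := by
  refine ⟨127 / 128, by norm_num, by norm_num, ?_⟩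
  intro d n M N ψ hψ δ' hδ0 hδ1 ν _ hν
  have hd : (0 : ℝ) < d := by exact_mod_cast AvgDist.dim_pos hψ
  have hδd : δ' / (2 * (d : ℝ)) ^ 8 * d ^ 8 ≤ 1 / 768 := by
    have : δ' / (2 * (d : ℝ)) ^ 8 * d ^ 8 = δ' / 256 := by field_simp; norm_num
    rw [this]
    linarith
  have hterm : ∀ i, |∫ V, |AvgDist.outcomeProb M ψ V i - AvgDist.outcomeProb N ψ V i| ∂ν
      - AvgDist.traceHsNorm (M.effect i - N.effect i) / d|
        ≤ 127 / 128 * (AvgDist.traceHsNorm (M.effect i - N.effect i) / d) := fun i => by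
    have h := AvgDist.design_integral_abs_expVal hψ
      ((M.posSemidef i).isHermitian.sub (N.posSemidef i).isHermitian) (by positivity) hδd hν
    simp only [AvgDist.expVal_sub, Complex.sub_re] at h
    exact h
  have hint : ∀ i, Integrable
      (fun V => |AvgDist.outcomeProb M ψ V i - AvgDist.outcomeProb N ψ V i|) ν := fun i =>
    AvgDist.integrable_of_continuous ν
      ((Complex.continuous_re.comp (AvgDist.continuous_expVal ψ (M.effect i))).sub
        (Complex.continuous_re.comp (AvgDist.continuous_expVal ψ (N.effect i)))).abs
  have hav : AvgDist.avgDistMeas M N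
      = 1 / 2 * ∑ i, AvgDist.traceHsNorm (M.effect i - N.effect i) / d := by
    simp only [AvgDist.avgDistMeas, AvgDist.traceHsNorm]
    rw [← Finset.sum_div]
    field_simp
  have htv : ∫ V, AvgDist.tvDist (AvgDist.outcomeProb M ψ V) (AvgDist.outcomeProb N ψ V) ∂ν
      = 1 / 2 * ∑ i, ∫ V, |AvgDist.outcomeProb M ψ V i - AvgDist.outcomeProb N ψ V i| ∂ν := by
    simp only [AvgDist.tvDist]
    rw [integral_const_mul, integral_finsetSum _ fun i _ => hint i]
  rw [htv, hav, ← mul_sub, ← Finset.sum_sub_distrib, abs_mul, abs_of_pos (by norm_num),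
    mul_left_comm, Finset.mul_sum]
  gcongr
  exact (Finset.abs_sum_le_sum_abs _ _).trans (Finset.sum_le_sum fun i _ => hterm i)
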